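/- For a finite group $G$, let $\mathrm{Irr}(G)$ be the set of irreducible complex characters of $G$, and let $\mathrm{cd}(G)=\{\chi(1)\mid \chi\in\mathrm{Irr}(G)\}$ be the set of character degrees. For $\chi\in\mathrm{Irr}(G)$ let $\ker\chi=\{g\in G\mid \chi(g)=\chi(1)\}$, let $\mathrm{cod}(\chi)=|G:\ker\chi|/\chi(1)$ be the codegree of $\chi$, and let $\mathrm{cod}(G)=\{\mathrm{cod}(\chi)\mid\chi\in\mathrm{Irr}(G)\}$. Let $p$ be a prime and let $G$ be a $p$-group of maximal class with $|G|=p^n$ (that is, $n\ge 2$ and $G$ has nilpotency class $n-1$). If $\mathrm{cd}(G)=\{1,p,p^2\}$, then $$\mathrm{cod}(G)=\{p^i\mid 0\le i\le n-2\}.$$ -/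

import Mathlib

/-- `χ` is an irreducible complex character of `G`: the trace function of an irreducible
representation of `G` on some `ℂ^d`. -/
def IsIrrChar {G : Type*} [Group G] (χ : G → ℂ) : Prop :=
  ∃ (d : ℕ) (ρ : Representation ℂ G (Fin d → ℂ)), ρ.IsIrreducible ∧ ρ.character = χ

/-- `Irr(G)`, the set of irreducible complex characters of `G`. -/
def Irr (G : Type*) [Group G] : Set (G → ℂ) := {χ | IsIrrChar χ}

/-- `cd(G) = {χ(1) : χ ∈ Irr(G)}`, the set of character degrees. -/
def cd (G : Type*) [Group G] : Set ℂ := Set.range fun χ : Irr G => χ.1 1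

/-- An element of a finite group on which the trace of a complex representation equals the
dimension acts trivially. -/
theorem rep_eq_one_iff {G : Type*} [Group G] [Finite G] {d : ℕ}
    (ρ : Representation ℂ G (Fin d → ℂ)) (g : G) :
    ρ g = 1 ↔ ρ.character g = ρ.character 1 := by
  constructor
  · intro h
    simp [Representation.character, h]
  intro h
  obtain ⟨m, hm, hgm⟩ : ∃ m : ℕ, 0 < m ∧ g ^ m = 1 :=
    ⟨Nat.card G, Nat.card_pos, pow_card_eq_one'⟩
  set f : Module.End ℂ (Fin d → ℂ) := ρ g with hf
  have hfm : f ^ m = 1 := by rw [hf, ← map_pow, hgm, map_one]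
  have hroot : ∀ μ ∈ f.charpoly.roots, ‖μ‖ = 1 := by
    intro μ hμ
    have h1 : f.HasEigenvalue μ := by
      rw [Module.End.hasEigenvalue_iff_isRoot_charpoly]
      exact Polynomial.isRoot_of_mem_roots hμ
    obtain ⟨v, hv⟩ := h1.exists_hasEigenvector
    have h2 : μ ^ m • v = v := by
      rw [← hv.pow_apply, hfm, Module.End.one_apply]
    have h3 : μ ^ m = 1 := by
      by_contra hne
      have h4 : (μ ^ m - 1) • v = 0 := by rw [sub_smul, h2, one_smul, sub_self]
      rcases smul_eq_zero.mp h4 with h5 | h5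
      · exact hne (sub_eq_zero.mp h5)
      · exact hv.2 h5
    exact Complex.norm_eq_one_of_pow_eq_one h3 hm.ne'
  have hcard : f.charpoly.roots.card = d := by
    have := (IsAlgClosed.splits f.charpoly).natDegree_eq_card_roots
    rw [← this, LinearMap.charpoly_natDegree, Module.finrank_fin_fun]
  have hsum : f.charpoly.roots.sum = d := by
    have h1 : LinearMap.trace ℂ _ f = f.charpoly.roots.sum :=
      Module.End.trace_eq_sum_roots_charpoly_of_splits (IsAlgClosed.splits _)
    rw [← h1]
    simpa [Representation.character] using h
  have hone : ∀ μ ∈ f.charpoly.roots, μ = 1 := by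
    have h1 : (f.charpoly.roots.map fun μ => 1 - μ.re).sum = 0 := by
      have h2 : (f.charpoly.roots.map fun μ => μ.re).sum = d := by
        have := congrArg Complex.reAddGroupHom hsum
        rw [map_multiset_sum] at this
        simpa using this
      rw [Multiset.sum_map_sub, h2]
      simp [hcard]
    have h3 : ∀ x ∈ (f.charpoly.roots.map fun μ => 1 - μ.re), 0 ≤ x := by
      intro x hx
      obtain ⟨μ, hμ, rfl⟩ := Multiset.mem_map.mp hx
      have := Complex.re_le_norm μ
      rw [hroot μ hμ] at this
      linarith
    intro μ hμ
    have h4 : 1 - μ.re = 0 := Multiset.all_zero_of_le_zero_le_of_sum_eq_zero h3 h1 _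
      (Multiset.mem_map_of_mem (fun μ : ℂ => 1 - μ.re) hμ)
    have h5 : μ.re = 1 := by linarith
    have h6 := Complex.sq_norm μ
    rw [hroot μ hμ, Complex.normSq_apply, h5] at h6
    have h7 : μ.im = 0 := by nlinarith
    exact Complex.ext (by simpa using h5) (by simpa using h7)
  have hpoly : f.charpoly = (Polynomial.X - Polynomial.C 1) ^ d := by
    have h1 := (IsAlgClosed.splits f.charpoly).eq_prod_roots_of_monic f.charpoly_monic
    rw [Multiset.eq_replicate.mpr ⟨hcard, hone⟩] at h1
    simpa using h1
  have hnil : IsNilpotent (f - 1) := by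
    refine ⟨d, ?_⟩
    have := f.aeval_self_charpoly
    rw [hpoly] at this
    simpa using this
  have hss : f.IsSemisimple := by
    refine Module.End.isSemisimple_of_squarefree_aeval_eq_zero
      (p := Polynomial.X ^ m - 1) ?_ (by simp [hfm])
    have : (Polynomial.X ^ m - 1 : Polynomial ℂ).Separable :=
      Polynomial.X_pow_sub_one_separable_iff.mpr (by exact_mod_cast hm.ne')
    exact this.squarefree
  have hss' : (f - 1).IsSemisimple := by
    have := (Module.End.isSemisimple_sub_algebraMap_iff (f := f) (μ := (1 : ℂ))).mpr hss
    simpa using this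
  exact sub_eq_zero.mp (Module.End.eq_zero_of_isNilpotent_isSemisimple hnil hss')

/-- The kernel `ker χ = {g ∈ G : χ(g) = χ(1)}` of an irreducible character of a finite group. -/
def charKer {G : Type*} [Group G] [Finite G] (χ : Irr G) : Subgroup G where
  carrier := {g | χ.1 g = χ.1 1}
  one_mem' := rfl
  mul_mem' := by
    obtain ⟨χ, d, ρ, -, rfl⟩ := χ
    intro a b ha hb
    have ha' := (rep_eq_one_iff ρ a).mpr ha
    have hb' := (rep_eq_one_iff ρ b).mpr hb
    exact (rep_eq_one_iff ρ (a * b)).mp (by rw [map_mul, ha', hb', one_mul])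
  inv_mem' := by
    obtain ⟨χ, d, ρ, -, rfl⟩ := χ
    intro a ha
    have ha' := (rep_eq_one_iff ρ a).mpr ha
    refine (rep_eq_one_iff ρ a⁻¹).mp ?_
    have h : ρ a⁻¹ * ρ a = 1 := by rw [← map_mul, inv_mul_cancel, map_one]
    rwa [ha', mul_one] at h

/-- The codegree `|G : ker χ| / χ(1)`. -/
noncomputable def codegree {G : Type*} [Group G] [Finite G] (χ : Irr G) : ℂ :=
  ((charKer χ).index : ℂ) / χ.1 1

/-- `cod(G)`, the set of codegrees of the irreducible characters of `G`. -/
def cod (G : Type*) [Group G] [Finite G] : Set ℂ := Set.range fun χ : Irr G => codegree χ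

/-- `G` is a `p`-group of maximal class: it has order `p ^ n` with `n ≥ 2` and nilpotency class
`n - 1`. -/
def IsMaximalClass (p : ℕ) (G : Type*) [Group G] : Prop :=
  ∃ n : ℕ, 2 ≤ n ∧ Nat.card G = p ^ n ∧ Group.IsNilpotent G ∧ Group.nilpotencyClass G = n - 1

/-! Induct on `n`, passing from `G` to `G/Z` with `Z` the centre. Maximal class forces `|Z| = p`
when `n ≥ 3`, and `G/Z` again has maximal class. Characters with `Z` in their kernel come from `G/Z`
with the same codegree; every other character is faithful, because a nontrivial normal subgroup of a
`p`-group meets `Z`. Hence `cod G` is `cod (G/Z)` together with the numbers `|G| / χ(1)` for `χ`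
faithful (`cod_eq_cod_quotient_union`).

The crux is that all faithful characters have the same degree. They are nonlinear, so the degree is
`p` or `p ^ 2`. If one has degree `p`, the centralizer of a noncentral element of the second centre
is abelian of index at most `p`, so no irreducible degree exceeds `p`
(`Irr.apply_one_le_of_charKer_eq_bot`). Thus once `p ^ 2` occurs, faithful characters contribute
exactly `p ^ (n - 2)`; otherwise they contribute `p ^ (n - 1)`. Since `G/Z` may lose the degree `p ^
2`, both cases are carried through the induction (`cod_of_nilpotencyClass_eq`). -/

open Module

namespace Representation

/-! ### Irreducibility, and constituents of representations of finite groups -/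

section Field

variable {k G V W : Type*} [Field k] [Group G] [AddCommGroup V] [Module k V] [AddCommGroup W]
  [Module k W]

theorem isIrreducible_iff_forall_submodule (ρ : Representation k G V) :
    ρ.IsIrreducible ↔
      Nontrivial V ∧ ∀ U : Submodule k V, (∀ g, ∀ v ∈ U, ρ g v ∈ U) → U = ⊥ ∨ U = ⊤ := by
  constructor
  · intro h
    constructor
    · by_contra hV
      rw [not_nontrivial_iff_subsingleton] at hV
      refine bot_ne_top (α := Subrepresentation ρ) ?_
      exact Subrepresentation.toSubmodule_injective (Subsingleton.elim _ _)
    · intro U hU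
      rcases h.eq_bot_or_eq_top ⟨U, fun g v hv => hU g v hv⟩ with h1 | h1
      · exact Or.inl (congrArg Subrepresentation.toSubmodule h1)
      · exact Or.inr (congrArg Subrepresentation.toSubmodule h1)
  · rintro ⟨hV, hU⟩
    have : Nontrivial (Subrepresentation ρ) :=
      ⟨⊥, ⊤, fun h => bot_ne_top (congrArg Subrepresentation.toSubmodule h : (⊥ : Submodule k V) = ⊤)⟩
    refine ⟨fun U => ?_⟩
    rcases hU U.toSubmodule fun g v hv => U.apply_mem_toSubmodule g hv with h1 | h1
    · exact Or.inl (Subrepresentation.toSubmodule_injective h1)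
    · exact Or.inr (Subrepresentation.toSubmodule_injective h1)

theorem IsIrreducible.nontrivial {ρ : Representation k G V} (h : ρ.IsIrreducible) :
    Nontrivial V :=
  ((isIrreducible_iff_forall_submodule ρ).mp h).1

theorem IsIrreducible.eq_bot_or_eq_top_of_forall_mem {ρ : Representation k G V}
    (h : ρ.IsIrreducible) {U : Submodule k V} (hU : ∀ g, ∀ v ∈ U, ρ g v ∈ U) : U = ⊥ ∨ U = ⊤ :=
  ((isIrreducible_iff_forall_submodule ρ).mp h).2 U hU

theorem IsIrreducible.conj {ρ : Representation k G V} (h : ρ.IsIrreducible) (e : V ≃ₗ[k] W)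
    {σ : Representation k G W} (hσ : ∀ g v, σ g (e v) = e (ρ g v)) : σ.IsIrreducible := by
  have := h.nontrivial
  refine (isIrreducible_iff_forall_submodule σ).mpr ⟨e.symm.toEquiv.nontrivial, fun U hU => ?_⟩
  rcases h.eq_bot_or_eq_top_of_forall_mem (U := U.comap (e : V →ₗ[k] W)) fun g v hv => by
      simpa [hσ] using hU g _ hv with h1 | h1
  · left
    rw [eq_bot_iff]
    intro w hw
    have : e.symm w ∈ U.comap (e : V →ₗ[k] W) := by simpa using hw
    rw [h1] at this
    simpa using this
  · right
    rw [eq_top_iff]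
    intro w _
    have : e.symm w ∈ U.comap (e : V →ₗ[k] W) := by rw [h1]; trivial
    simpa using this

/-- Irreducibility depends only on the image of the group. -/
theorem isIrreducible_comp_iff {H : Type*} [Group H] (ρ : Representation k H V) {f : G →* H}
    (hf : Function.Surjective f) : IsIrreducible (ρ.comp f : Representation k G V) ↔
      ρ.IsIrreducible := by
  rw [isIrreducible_iff_forall_submodule, isIrreducible_iff_forall_submodule]
  refine and_congr_right fun _ => forall_congr' fun U => imp_congr_left ?_
  exact ⟨fun h g => by obtain ⟨x, rfl⟩ := hf g; exact h x, fun h g => h (f g)⟩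

/-- A finite-dimensional representation of a finite group on which `z` acts nontrivially has an
irreducible subrepresentation on which `z` acts nontrivially. -/
theorem exists_isIrreducible_subrepresentation [Finite G] [NeZero (Nat.card G : k)]
    [FiniteDimensional k V] (ρ : Representation k G V) {z : G} (hz : ρ z ≠ 1) :
    ∃ U : Subrepresentation ρ, U.toRepresentation.IsIrreducible ∧ U.toRepresentation z ≠ 1 := by
  -- Take `U` of least dimension among subrepresentations not fixed pointwise by `z`. A proper
  -- nonzero invariant `W` in `U` would, by Maschke, split `U` into two smaller pieces, both fixed
  -- by `z`.
  have hex : ∃ (n : ℕ) (U : Subrepresentation ρ), finrank k U.toSubmodule = n ∧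
      ∃ v ∈ U.toSubmodule, ρ z v ≠ v := by
    refine ⟨_, ⊤, rfl, ?_⟩
    by_contra! h
    exact hz (LinearMap.ext fun v => h v Submodule.mem_top)
  classical
  obtain ⟨U, hUn, v, hv, hzv⟩ := Nat.find_spec hex
  have hmin : ∀ W : Subrepresentation ρ, W.toSubmodule < U.toSubmodule →
      ∀ v ∈ W.toSubmodule, ρ z v = v := by
    intro W hW
    by_contra! h
    exact Nat.find_min hex (hUn ▸ Submodule.finrank_lt_finrank_of_lt hW) ⟨W, rfl, h⟩
  refine ⟨U, (isIrreducible_iff_forall_submodule _).mpr ⟨?_, fun W hW => ?_⟩, fun h => hzv ?_⟩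
  · refine ⟨⟨⟨v, hv⟩, 0, fun h => hzv ?_⟩⟩
    have : v = 0 := congrArg Subtype.val h
    simp [this]
  · by_contra! hne
    let W' : Subrepresentation ρ := ⟨W.map U.toSubmodule.subtype, by
      rintro g _ ⟨w, hw, rfl⟩
      exact ⟨_, hW g w hw, rfl⟩⟩
    have hWU : W'.toSubmodule ≤ U.toSubmodule := Submodule.map_subtype_le _ _
    obtain ⟨C, hC⟩ := exists_isCompl W'
    have hsup : W'.toSubmodule ⊔ C.toSubmodule = ⊤ :=
      congrArg Subrepresentation.toSubmodule hC.sup_eq_top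
    have hinf : W'.toSubmodule ⊓ C.toSubmodule = ⊥ :=
      congrArg Subrepresentation.toSubmodule hC.inf_eq_bot
    have hW'lt : W'.toSubmodule < U.toSubmodule := by
      refine lt_of_le_of_ne hWU fun h => hne.2 ?_
      rw [eq_top_iff]
      intro w _
      have : (w : V) ∈ W'.toSubmodule := by rw [h]; exact w.2
      obtain ⟨w', hw', h'⟩ := this
      rwa [← Subtype.ext h']
    have hClt : (C ⊓ U).toSubmodule < U.toSubmodule := by
      refine lt_of_le_of_ne inf_le_right fun h => hne.1 ?_
      have hUC : U.toSubmodule ≤ C.toSubmodule := h.symm.le.trans inf_le_left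
      have h0 : W'.toSubmodule = ⊥ := by
        rw [← hinf]; exact (inf_eq_left.mpr (hWU.trans hUC)).symm
      exact Submodule.map_injective_of_injective U.toSubmodule.injective_subtype
        (h0.trans (Submodule.map_bot _).symm)
    obtain ⟨w, hw, c, hc, rfl⟩ := Submodule.mem_sup.mp (hsup ▸ Submodule.mem_top : v ∈ _)
    have hcU : c ∈ U.toSubmodule := by
      have := U.toSubmodule.sub_mem hv (hWU hw)
      simpa using this
    exact hzv (by rw [map_add, hmin W' hW'lt w hw, hmin _ hClt c ⟨hc, hcU⟩])
  · exact congrArg Subtype.val (LinearMap.congr_fun h ⟨v, hv⟩)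

end Field

/-! ### Schur's lemma and degree bounds over an algebraically closed field -/

section IsAlgClosed

variable {k G V : Type*} [Field k] [IsAlgClosed k] [Group G] [AddCommGroup V] [Module k V]
  [FiniteDimensional k V] {ρ : Representation k G V}

/-- Schur's lemma for central elements. -/
theorem IsIrreducible.exists_eq_smul_one_of_mem_center (h : ρ.IsIrreducible) {z : G}
    (hz : z ∈ Subgroup.center G) : ∃ c : k, ρ z = c • 1 := by
  have := h.nontrivial
  obtain ⟨c, hc⟩ := Module.End.exists_eigenvalue (ρ z)
  refine ⟨c, ?_⟩
  rcases h.eq_bot_or_eq_top_of_forall_mem (U := Module.End.eigenspace (ρ z) c) fun g v hv => by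
      rw [Module.End.mem_eigenspace_iff] at hv ⊢
      rw [← Module.End.mul_apply, ← map_mul, ← Subgroup.mem_center_iff.mp hz g, map_mul,
        Module.End.mul_apply, hv, map_smul] with h1 | h1
  · exact absurd h1 hc
  · ext v
    exact Module.End.mem_eigenspace_iff.mp (h1 ▸ Submodule.mem_top : v ∈ _)

/-- A representation of an abelian group on a nonzero space has a common eigenvector. -/
theorem exists_forall_apply_eq_smul_of_comm [Nontrivial V] (ρ : Representation k G V)
    (hcomm : ∀ a b : G, a * b = b * a) : ∃ v ≠ (0 : V), ∀ g, ∃ c : k, ρ g v = c • v := by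
  -- In a nonzero invariant subspace of least dimension, each eigenspace of each `ρ g` is invariant
  -- by commutativity, so a nonzero one is everything.
  have hex : ∃ (n : ℕ) (U : Submodule k V), finrank k U = n ∧ U ≠ ⊥ ∧
      ∀ g, ∀ v ∈ U, ρ g v ∈ U := ⟨_, ⊤, rfl, top_ne_bot, fun _ _ _ => Submodule.mem_top⟩
  classical
  obtain ⟨U, hUn, hU0, hU⟩ := Nat.find_spec hex
  obtain ⟨v, hv, hv0⟩ := U.ne_bot_iff.mp hU0
  refine ⟨v, hv0, fun g => ?_⟩
  have : Nontrivial U := Submodule.nontrivial_iff_ne_bot.mpr hU0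
  obtain ⟨c, hc⟩ := Module.End.exists_eigenvalue ((ρ g).restrict (hU g))
  obtain ⟨w, hw⟩ := hc.exists_hasEigenvector
  refine ⟨c, ?_⟩
  have hgw : ρ g w = c • (w : V) := congrArg Subtype.val hw.apply_eq_smul
  have hle : U ⊓ Module.End.eigenspace (ρ g) c = U := by
    by_contra hne
    have hlt : U ⊓ Module.End.eigenspace (ρ g) c < U := lt_of_le_of_ne inf_le_left hne
    refine Nat.find_min hex (hUn ▸ Submodule.finrank_lt_finrank_of_lt hlt)
      ⟨_, rfl, ?_, fun x u hu => Submodule.mem_inf.mpr ⟨hU x u hu.1, ?_⟩⟩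
    · refine (Submodule.ne_bot_iff _).mpr ⟨w, ⟨w.2, Module.End.mem_eigenspace_iff.mpr hgw⟩, ?_⟩
      simpa using hw.2
    · have h2 := Module.End.mem_eigenspace_iff.mp hu.2
      refine Module.End.mem_eigenspace_iff.mpr ?_
      rw [← Module.End.mul_apply, ← map_mul, hcomm, map_mul, Module.End.mul_apply, h2, map_smul]
  exact Module.End.mem_eigenspace_iff.mp (hle.symm.le hv).2

/-- The degree of an irreducible representation is at most the index of any abelian subgroup. -/
theorem IsIrreducible.finrank_le_index [Finite G] (h : ρ.IsIrreducible) (H : Subgroup G)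
    (hH : ∀ a ∈ H, ∀ b ∈ H, a * b = b * a) : finrank k V ≤ H.index := by
  have := h.nontrivial
  obtain ⟨v, hv0, hv⟩ := exists_forall_apply_eq_smul_of_comm
    (ρ.comp H.subtype : Representation k H V) fun a b => Subtype.ext (hH a a.2 b b.2)
  -- `H` only rescales `v`, so one translate per coset spans an invariant subspace.
  let b : G ⧸ H → V := fun q => ρ q.out v
  have hb : ∀ g, ρ g v ∈ Submodule.span k (Set.range b) := by
    intro g
    obtain ⟨x, hx⟩ := QuotientGroup.mk_out_eq_mul H g
    obtain ⟨c, hc⟩ := hv x⁻¹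
    have hg : ρ g v = c • b (g : G ⧸ H) := by
      change ρ g v = c • ρ _ v
      rw [← map_smul, ← hc, hx]
      simp [← Module.End.mul_apply, ← map_mul]
    rw [hg]
    exact Submodule.smul_mem _ _ (Submodule.subset_span ⟨_, rfl⟩)
  have htop : Submodule.span k (Set.range b) = ⊤ := by
    refine (h.eq_bot_or_eq_top_of_forall_mem fun g w hw => ?_).resolve_left fun h0 => hv0 ?_
    · induction hw using Submodule.span_induction with
      | mem x hx =>
        obtain ⟨q, rfl⟩ := hx
        have := hb (g * q.out)
        rwa [map_mul] at this
      | zero => simp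
      | add x y _ _ hx hy => rw [map_add]; exact add_mem hx hy
      | smul c x _ hx => rw [map_smul]; exact Submodule.smul_mem _ _ hx
    · have := hb 1
      rw [h0] at this
      simpa using this
  have := Fintype.ofFinite (G ⧸ H)
  calc finrank k V = Set.finrank k (Set.range b) := by rw [Set.finrank, htop, finrank_top]
    _ ≤ Fintype.card (G ⧸ H) := finrank_range_le_card b
    _ = H.index := by rw [Subgroup.index, Nat.card_eq_fintype_card]

end IsAlgClosed

end Representation

/-- If an endomorphism of a `d`-dimensional space has `d` distinct eigenvalues, then its centralizer
is commutative. -/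
theorem Module.End.commute_of_hasEigenvector_of_injective {k V ι : Type*} [Field k]
    [AddCommGroup V] [Module k V] [Fintype ι] [Nonempty ι] (hι : Fintype.card ι = finrank k V)
    {A B C : Module.End k V} {μ : ι → k} (hμ : Function.Injective μ) {v : ι → V}
    (hv : ∀ i, A.HasEigenvector (μ i) (v i)) (hB : Commute A B) (hC : Commute A C) :
    Commute B C := by
  let b := basisOfLinearIndependentOfCardEqFinrank
    (Module.End.eigenvectors_linearIndependent' A μ hμ v hv) hι
  have hb : ∀ i, b i = v i := fun i => by simp [b]
  have hA : ∀ w i, b.repr (A w) i = μ i * b.repr w i := by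
    intro w i
    conv_lhs => rw [← b.sum_repr w]
    simp only [map_sum, map_smul, hb, (hv _).apply_eq_smul]
    simp only [← hb, Finsupp.coe_finsetSum, Finset.sum_apply, Finsupp.smul_apply,
      b.repr_self, smul_eq_mul]
    rw [Finset.sum_eq_single i]
    · simp [mul_comm]
    · intro j _ hj
      simp [hj]
    · simp
  have key : ∀ {D : Module.End k V}, Commute A D → ∀ i, ∃ c : k, D (b i) = c • b i := by
    intro D hD i
    refine ⟨b.repr (D (b i)) i, b.repr.injective (Finsupp.ext fun j => ?_)⟩
    rcases eq_or_ne j i with rfl | hj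
    · simp
    -- Compare `j`-th coordinates in `A D vᵢ = D A vᵢ`: the off-diagonal entry is killed by `μ i - μ
    -- j ≠ 0`.
    · have h1 := hA (D (b i)) j
      rw [← Module.End.mul_apply, hD.eq, Module.End.mul_apply, hb i, (hv i).apply_eq_smul, map_smul,
        map_smul, Finsupp.smul_apply, smul_eq_mul] at h1
      have h2 : (μ i - μ j) * b.repr (D (v i)) j = 0 := by rw [sub_mul, h1, sub_self]
      have h3 := (mul_eq_zero.mp h2).resolve_left (sub_ne_zero.mpr (hμ.ne hj.symm))
      rw [hb i, h3, map_smul, ← hb i]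
      simp [hj.symm]
  refine b.ext fun i => ?_
  obtain ⟨c, hc⟩ := key hB i
  obtain ⟨d, hd⟩ := key hC i
  rw [Module.End.mul_apply, Module.End.mul_apply, hc, hd, map_smul, map_smul, hc, hd, smul_comm]

/-! ### Second centre, maximal class and the order of the centre -/

section Group

variable {G : Type*} [Group G]

/-- For `a` in the second centre, the homomorphism `g ↦ [g, a]` into the centre. -/
def commutatorHomCenter (a : G) (ha : ∀ g : G, g * a * g⁻¹ * a⁻¹ ∈ Subgroup.center G) :
    G →* Subgroup.center G :=
  MonoidHom.mk' (fun g => ⟨g * a * g⁻¹ * a⁻¹, ha g⟩) fun g h => Subtype.ext <| by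
    have h1 := Subgroup.mem_center_iff.mp (ha h) g
    change g * h * a * (g * h)⁻¹ * a⁻¹ = g * a * g⁻¹ * a⁻¹ * (h * a * h⁻¹ * a⁻¹)
    calc g * h * a * (g * h)⁻¹ * a⁻¹ = g * (h * a * h⁻¹ * a⁻¹) * (a * g⁻¹ * a⁻¹) := by group
      _ = (h * a * h⁻¹ * a⁻¹) * (g * a * g⁻¹ * a⁻¹) := by rw [h1]; group
      _ = _ := (Subgroup.mem_center_iff.mp (ha h) _).symm

theorem mem_ker_commutatorHomCenter {a : G}
    {ha : ∀ g : G, g * a * g⁻¹ * a⁻¹ ∈ Subgroup.center G} {g : G} :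
    g ∈ (commutatorHomCenter a ha).ker ↔ g * a = a * g := by
  rw [MonoidHom.mem_ker, ← Subtype.coe_inj]
  change g * a * g⁻¹ * a⁻¹ = 1 ↔ _
  rw [mul_inv_eq_one, mul_inv_eq_iff_eq_mul]

variable [Finite G]

/-- The centralizer of `a` is the kernel of `g ↦ [g, a]`, so its index is at most `p`. A nontrivial
`[g, a]` acts under `ρ` as a primitive `p`-th root of unity, which gives `ρ a` as many distinct
eigenvalues as the dimension `p`. Its commutant is therefore commutative, and faithfulness makes the
centralizer abelian. -/
theorem Representation.finrank_le_of_injective_of_finrank_eq_card_center {k V W : Type*} [Field k]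
    [IsAlgClosed k] [AddCommGroup V] [Module k V] [FiniteDimensional k V] [AddCommGroup W]
    [Module k W] [FiniteDimensional k W] {p : ℕ} (hp : p.Prime)
    (hZ : Nat.card (Subgroup.center G) = p) {a : G} (ha : a ∉ Subgroup.center G)
    (ha' : ∀ g : G, g * a * g⁻¹ * a⁻¹ ∈ Subgroup.center G)
    {ρ : Representation k G V} (hρ : ρ.IsIrreducible) (hinj : Function.Injective ρ)
    (hdim : finrank k V = p) {σ : Representation k G W} (hσ : σ.IsIrreducible) :
    finrank k W ≤ p := by
  have hindex : (commutatorHomCenter a ha').ker.index ≤ p := by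
    rw [Subgroup.index_ker, ← hZ]
    exact Subgroup.card_le_card_group _
  refine (hσ.finrank_le_index _ fun x hx y hy => hinj ?_).trans hindex
  rw [map_mul, map_mul]
  rw [mem_ker_commutatorHomCenter] at hx hy
  have hnt := hρ.nontrivial
  obtain ⟨g, hg⟩ : ∃ g, g * a ≠ a * g := by
    by_contra! h
    exact ha (Subgroup.mem_center_iff.mpr h)
  set z := g * a * g⁻¹ * a⁻¹ with hz
  obtain ⟨c, hc⟩ := hρ.exists_eq_smul_one_of_mem_center (ha' g)
  have hz1 : z ≠ 1 := fun h => hg (by rwa [hz, mul_inv_eq_one, mul_inv_eq_iff_eq_mul] at h)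
  have hzp : z ^ p = 1 := by
    have := pow_card_eq_one' (x := (⟨z, ha' g⟩ : Subgroup.center G))
    rw [hZ] at this
    exact congrArg Subtype.val this
  have hone : ∀ d : k, d • (1 : Module.End k V) = 1 → d = 1 := by
    intro d hd
    obtain ⟨v, hv⟩ := exists_ne (0 : V)
    have h1 : d • v = v := LinearMap.congr_fun hd v
    have h2 : (d - 1) • v = 0 := by rw [sub_smul, h1, one_smul, sub_self]
    exact sub_eq_zero.mp ((smul_eq_zero.mp h2).resolve_right hv)
  have hc1 : c ≠ 1 := by
    rintro rfl
    exact hz1 (hinj (by rw [hc, map_one, one_smul]))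
  have hcp : c ^ p = 1 := hone _ <| by
    rw [← one_pow (M := Module.End k V) p, ← smul_pow, ← hc, ← map_pow, ← hz, hzp, map_one, one_pow]
  have hprim : IsPrimitiveRoot c p := by
    have := Fact.mk hp
    exact (orderOf_eq_prime hcp hc1) ▸ IsPrimitiveRoot.orderOf c
  obtain ⟨μ, hμ⟩ := Module.End.exists_eigenvalue (ρ a)
  obtain ⟨v, hv⟩ := hμ.exists_hasEigenvector
  have hμ0 : μ ≠ 0 := by
    rintro rfl
    have h1 := hv.apply_eq_smul
    rw [zero_smul] at h1
    exact hv.2 ((ρ.apply_bijective a).1 (h1.trans (map_zero _).symm))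
  have hza : ∀ w, ρ g (ρ a w) = c • ρ a (ρ g w) := by
    intro w
    have h1 : ρ (g * a) = ρ (z * (a * g)) := by rw [hz]; congr 1; group
    rw [map_mul, map_mul, hc, map_mul] at h1
    exact LinearMap.congr_fun h1 w
  have hc0 : c ≠ 0 := hprim.ne_zero hp.ne_zero
  -- Since `ρ g ρ a = c ρ a ρ g`, each application of `ρ g` multiplies the eigenvalue by `c⁻¹`.
  have hstep : ∀ i : ℕ, (ρ a) (ρ (g ^ i) v) = ((c⁻¹) ^ i * μ) • ρ (g ^ i) v := by
    intro i
    induction i with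
    | zero => simpa using hv.apply_eq_smul
    | succ i ih =>
      rw [pow_succ' g, map_mul, Module.End.mul_apply]
      have h1 := hza (ρ (g ^ i) v)
      rw [ih, map_smul] at h1
      rw [pow_succ', mul_assoc, mul_smul, h1, smul_smul, inv_mul_cancel₀ hc0, one_smul]
  have hne : Nonempty (Fin p) := ⟨⟨0, hp.pos⟩⟩
  refine (Module.End.commute_of_hasEigenvector_of_injective (ι := Fin p) (A := ρ a)
    (μ := fun i => (c⁻¹) ^ (i : ℕ) * μ) (v := fun i => ρ (g ^ (i : ℕ)) v) (by simp [hdim]) ?_ ?_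
    ?_ ?_).eq
  · intro i j hij
    exact Fin.ext (hprim.inv.pow_inj i.2 j.2 (mul_right_cancel₀ hμ0 hij))
  · exact fun i => ⟨Module.End.mem_eigenspace_iff.mpr (hstep i),
      fun h => hv.2 ((ρ.apply_bijective _).1 (h.trans (map_zero _).symm))⟩
  · exact (by rw [← map_mul, ← hx, map_mul] : ρ a * ρ x = ρ x * ρ a)
  · exact (by rw [← map_mul, ← hy, map_mul] : ρ a * ρ y = ρ y * ρ a)

section PGroup

variable {p : ℕ}

theorem IsPGroup.inf_center_ne_bot [Fact p.Prime] (hG : IsPGroup p G) {N : Subgroup G} [N.Normal]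
    (hN : N ≠ ⊥) : N ⊓ Subgroup.center G ≠ ⊥ := by
  -- Fixed points of conjugation on `N` are its central elements; `p` divides their number, so `1`
  -- is not alone.
  let _ : MulAction G N := MulAction.compHom N (MulAut.conjNormal : G →* MulAut N)
  have hsmul : ∀ (g : G) (n : N), ((g • n : N) : G) = g * n * g⁻¹ := fun g n =>
    MulAut.conjNormal_apply g n
  have hcard : p ∣ Nat.card N :=
    (hG.to_subgroup N).card_eq_or_dvd.resolve_left fun h => hN (Subgroup.card_eq_one.mp h)
  obtain ⟨n, hn, hn1⟩ := hG.exists_fixed_point_of_prime_dvd_card_of_fixed_point N hcard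
    (a := 1) (fun g => Subtype.ext (by rw [hsmul]; simp))
  refine Subgroup.ne_bot_iff_exists_ne_one.mpr ⟨⟨n, n.2, Subgroup.mem_center_iff.mpr fun g => ?_⟩,
    fun h => hn1 (Subtype.ext (congrArg Subtype.val h).symm)⟩
  have := hsmul g n
  rw [hn g] at this
  exact (mul_inv_eq_iff_eq_mul.mp this.symm)

omit [Finite G] in
theorem isCyclic_of_card_eq_prime_pow_of_le_one (hp : p.Prime) {j : ℕ} (hj : j ≤ 1)
    (h : Nat.card G = p ^ j) : IsCyclic G := by
  have := Fact.mk hp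
  interval_cases j
  · have := (Nat.card_eq_one_iff_unique.mp (by simpa using h)).1
    infer_instance
  · exact isCyclic_of_prime_card (p := p) (by simpa using h)

omit [Finite G] in
theorem nilpotencyClass_le_one_of_isCyclic_quotient_center
    [IsCyclic (G ⧸ Subgroup.center G)] : Group.nilpotencyClass G ≤ 1 := by
  have hcomm := MonoidHom.isMulCommutative_of_isCyclic_of_ker_le_center
    (QuotientGroup.mk' (Subgroup.center G)) (QuotientGroup.ker_mk' _).le
  let _ : CommGroup G := { ‹Group G› with mul_comm := isMulCommutative_iff.mp hcomm }
  exact CommGroup.nilpotencyClass_le_one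

omit [Finite G] in
theorem card_quotient_center_of_card_eq_prime_pow (hp : p.Prime) {n : ℕ} (hn : n ≠ 0)
    (h : Nat.card G = p ^ n) :
    ∃ j, 0 < j ∧ j ≤ n ∧ Nat.card (Subgroup.center G) = p ^ j ∧
      Nat.card (G ⧸ Subgroup.center G) = p ^ (n - j) := by
  have := Fact.mk hp
  obtain ⟨j, hj, hZ⟩ := IsPGroup.card_center_eq_prime_pow h (Nat.pos_of_ne_zero hn)
  have hmul := Subgroup.card_eq_card_quotient_mul_card_subgroup (Subgroup.center G)
  have hjn : j ≤ n := by
    rw [← Nat.pow_dvd_pow_iff_le_right hp.one_lt, ← h, ← hZ]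
    exact Subgroup.card_subgroup_dvd_card _
  refine ⟨j, hj, hjn, hZ, ?_⟩
  rw [h, hZ, ← Nat.sub_add_cancel hjn, pow_add] at hmul
  simpa using (Nat.eq_of_mul_eq_mul_right (pow_pos hp.pos j) hmul).symm

/-- A group of order `p ^ n` has nilpotency class at most `max 1 (n - 1)`. -/
theorem nilpotencyClass_le_of_card_eq_prime_pow (hp : p.Prime) (n : ℕ) :
    ∀ (G : Type*) [Group G] [Finite G], Nat.card G = p ^ n →
      Group.nilpotencyClass G ≤ max 1 (n - 1) := by
  induction n using Nat.strong_induction_on with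
  | _ n ih =>
    intro G _ _ h
    rcases Nat.eq_zero_or_pos n with rfl | hn
    · have := (Nat.card_eq_one_iff_unique.mp (by simpa using h)).1
      have : IsCyclic (G ⧸ Subgroup.center G) := inferInstance
      exact (nilpotencyClass_le_one_of_isCyclic_quotient_center (G := G)).trans (le_max_left _ _)
    obtain ⟨j, hj, hjn, -, hq⟩ := card_quotient_center_of_card_eq_prime_pow hp hn.ne' h
    by_cases hj' : n - j ≤ 1
    · have := isCyclic_of_card_eq_prime_pow_of_le_one hp hj' hq
      exact nilpotencyClass_le_one_of_isCyclic_quotient_center.trans (le_max_left _ _)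
    · have := ih (n - j) (by omega) _ hq
      rw [Group.nilpotencyClass_quotient_center] at this
      omega

/-- Factoring out the centre lowers the class by exactly one, so a centre of order at least `p ^ 2`
would leave a quotient too small for class `n - 2`, or make `G` abelian. -/
theorem card_center_of_nilpotencyClass_eq (hp : p.Prime) {n : ℕ} (hn : 3 ≤ n)
    (h : Nat.card G = p ^ n) (hc : Group.nilpotencyClass G = n - 1) :
    Nat.card (Subgroup.center G) = p ∧ Nat.card (G ⧸ Subgroup.center G) = p ^ (n - 1) := by
  obtain ⟨j, hj, hjn, hZ, hq⟩ := card_quotient_center_of_card_eq_prime_pow hp (by omega) h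
  obtain rfl : j = 1 := by
    by_contra hj1
    by_cases hj' : n - j ≤ 1
    · have := isCyclic_of_card_eq_prime_pow_of_le_one hp hj' hq
      have := nilpotencyClass_le_one_of_isCyclic_quotient_center (G := G)
      omega
    · have := nilpotencyClass_le_of_card_eq_prime_pow hp _ _ hq
      rw [Group.nilpotencyClass_quotient_center] at this
      omega
  exact ⟨by simpa using hZ, hq⟩

/-- A noncentral element of the second centre of a nonabelian `p`-group. -/
theorem IsPGroup.exists_notMem_center_forall_commutator_mem_center [Fact p.Prime]
    (hG : IsPGroup p G) [Nontrivial (G ⧸ Subgroup.center G)] :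
    ∃ a ∉ Subgroup.center G, ∀ g : G, g * a * g⁻¹ * a⁻¹ ∈ Subgroup.center G := by
  have := (hG.to_quotient (Subgroup.center G)).center_nontrivial
  obtain ⟨⟨b, hb⟩, hb1⟩ := exists_ne (1 : Subgroup.center (G ⧸ Subgroup.center G))
  obtain ⟨a, rfl⟩ := QuotientGroup.mk_surjective b
  refine ⟨a, fun ha => hb1 (Subtype.ext ((QuotientGroup.eq_one_iff a).mpr ha)), fun g => ?_⟩
  rw [← QuotientGroup.eq_one_iff]
  have := Subgroup.mem_center_iff.mp hb g
  rw [QuotientGroup.mk_mul, QuotientGroup.mk_mul, QuotientGroup.mk_mul, this]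
  simp

end PGroup

end Group

/-! ### Irreducible characters, kernels and codegrees -/

section Irr

variable {G : Type*} [Group G]

/-- `IsIrrChar` asks for a representation on some `ℂ^d`; a choice of basis supplies it. -/
theorem Representation.IsIrreducible.exists_coordinates {V : Type*} [AddCommGroup V] [Module ℂ V]
    [FiniteDimensional ℂ V] {ρ : Representation ℂ G V} (h : ρ.IsIrreducible) :
    ∃ (d : ℕ) (σ : Representation ℂ G (Fin d → ℂ)), σ.IsIrreducible ∧ ∀ g, σ g = 1 → ρ g = 1 := by
  let e : V ≃ₗ[ℂ] (Fin (finrank ℂ V) → ℂ) := (finBasis ℂ V).equivFun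
  let σ : Representation ℂ G (Fin (finrank ℂ V) → ℂ) :=
    (e.conjAlgEquiv ℂ : Module.End ℂ V →* _).comp ρ
  have hσ : ∀ g v, σ g (e v) = e (ρ g v) := fun g v =>
    congrArg (fun w => e (ρ g w)) (e.symm_apply_apply v)
  refine ⟨_, σ, h.conj e hσ, fun g hg => LinearMap.ext fun v => e.injective ?_⟩
  rw [← hσ, hg, Module.End.one_apply, Module.End.one_apply]

theorem IsIrrChar.comp {H : Type*} [Group H] {χ : H → ℂ} (h : IsIrrChar χ) {f : G →* H}
    (hf : Function.Surjective f) : IsIrrChar (χ ∘ f) := by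
  obtain ⟨d, ρ, hρ, rfl⟩ := h
  exact ⟨d, ρ.comp f, (Representation.isIrreducible_comp_iff ρ hf).mpr hρ, rfl⟩

theorem Irr.apply_one_eq_one_of_comm (χ : Irr G) (hG : ∀ a b : G, a * b = b * a) :
    χ.1 1 = 1 := by
  obtain ⟨χ, d, ρ, hρ, rfl⟩ := χ
  have : IsMulCommutative G := isMulCommutative_iff.mpr hG
  have := Representation.IsIrreducible.finrank_eq_one_of_isMulCommutative ρ
  simp [Representation.char_one, this]

variable [Finite G]

theorem mem_charKer {χ : Irr G} {g : G} : g ∈ charKer χ ↔ χ.1 g = χ.1 1 := Iff.rfl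

instance charKer_normal (χ : Irr G) : (charKer χ).Normal := by
  refine ⟨fun n hn g => ?_⟩
  obtain ⟨χ, d, ρ, hρ, rfl⟩ := χ
  rw [mem_charKer] at hn ⊢
  exact (Representation.char_conj ρ n g).trans hn

/-- The regular representation is faithful, so `z` acts nontrivially on one of its irreducible
constituents. -/
theorem exists_irr_notMem_charKer {z : G} (hz : z ≠ 1) : ∃ χ : Irr G, z ∉ charKer χ := by
  have : Fintype G := Fintype.ofFinite G
  have : FiniteDimensional ℂ (MonoidAlgebra ℂ G) :=
    Module.Finite.of_basis (MonoidAlgebra.basis ..)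
  have hreg : Representation.leftRegular ℂ G z ≠ 1 := by
    intro h
    have h1 := LinearMap.congr_fun h (MonoidAlgebra.single 1 1)
    rw [Representation.leftRegular, Representation.ofMulAction_single, smul_eq_mul, mul_one,
      Module.End.one_apply] at h1
    exact hz (MonoidAlgebra.single_left_injective one_ne_zero h1)
  obtain ⟨U, hU, hzU⟩ := Representation.exists_isIrreducible_subrepresentation _ hreg
  obtain ⟨d, σ, hσ, hσU⟩ := hU.exists_coordinates
  refine ⟨⟨_, d, σ, hσ, rfl⟩, fun hmem => hzU (hσU z ((rep_eq_one_iff σ z).mpr hmem))⟩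

/-- The codegree is invariant under inflation. -/
theorem codegree_comp {H : Type*} [Group H] [Finite H] (ψ : Irr H) {f : G →* H}
    (hf : Function.Surjective f) : codegree (⟨ψ.1 ∘ f, ψ.2.comp hf⟩ : Irr G) = codegree ψ := by
  have : charKer (⟨ψ.1 ∘ f, ψ.2.comp hf⟩ : Irr G) = (charKer ψ).comap f := by
    ext g
    simp [mem_charKer]
  rw [codegree, codegree, this, Subgroup.index_comap_of_surjective _ hf]
  simp

theorem exists_irr_quotient_of_le_charKer {N : Subgroup G} [N.Normal] (χ : Irr G)
    (h : N ≤ charKer χ) : ∃ ψ : Irr (G ⧸ N), χ.1 = ψ.1 ∘ QuotientGroup.mk' N := by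
  obtain ⟨χ, d, ρ, hρ, rfl⟩ := χ
  have hker : N ≤ ρ.ker := fun n hn => MonoidHom.mem_ker.mpr ((rep_eq_one_iff ρ n).mpr (h hn))
  let σ : Representation ℂ (G ⧸ N) (Fin d → ℂ) := QuotientGroup.lift N ρ hker
  have hσ : ρ = σ.comp (QuotientGroup.mk' N) := rfl
  refine ⟨⟨σ.character, d, σ, ?_, rfl⟩, rfl⟩
  rw [hσ] at hρ
  exact (Representation.isIrreducible_comp_iff σ (QuotientGroup.mk'_surjective N)).mp hρ

omit [Finite G] in
theorem cd_quotient_subset (N : Subgroup G) [N.Normal] : cd (G ⧸ N) ⊆ cd G := by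
  rintro _ ⟨ψ, rfl⟩
  exact ⟨⟨_, ψ.2.comp (QuotientGroup.mk'_surjective N)⟩, by simp⟩

theorem cod_eq_cod_quotient_union (N : Subgroup G) [N.Normal] :
    cod G = cod (G ⧸ N) ∪ codegree '' {χ : Irr G | ¬ N ≤ charKer χ} := by
  have hf := QuotientGroup.mk'_surjective N
  ext x
  constructor
  · rintro ⟨χ, rfl⟩
    by_cases h : N ≤ charKer χ
    · obtain ⟨ψ, hψ⟩ := exists_irr_quotient_of_le_charKer χ h
      refine Or.inl ⟨ψ, (codegree_comp ψ hf).symm.trans ?_⟩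
      exact congrArg codegree (Subtype.ext hψ.symm)
    · exact Or.inr ⟨χ, h, rfl⟩
  · rintro (⟨ψ, rfl⟩ | ⟨χ, -, rfl⟩)
    · exact ⟨_, codegree_comp ψ hf⟩
    · exact ⟨χ, rfl⟩

theorem codegree_of_charKer_eq_bot {χ : Irr G} (h : charKer χ = ⊥) :
    codegree χ = Nat.card G / χ.1 1 := by
  rw [codegree, h, Subgroup.index_bot]

/-- Modulo the kernel of a linear character, a finite group is cyclic. -/
theorem isCyclic_quotient_charKer {χ : Irr G} (h : χ.1 1 = 1) : IsCyclic (G ⧸ charKer χ) := by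
  obtain ⟨χ, d, ρ, hρ, rfl⟩ := χ
  obtain rfl : d = 1 := by simpa [Representation.char_one] using h
  -- In dimension one the trace is the determinant, hence multiplicative; the quotient by the kernel
  -- embeds in `ℂ`, where finite groups are cyclic.
  have hdet : ∀ f : Module.End ℂ (Fin 1 → ℂ), LinearMap.det f = LinearMap.trace ℂ _ f := by
    intro f
    rw [← LinearMap.det_toMatrix', LinearMap.trace_eq_matrix_trace ℂ (Pi.basisFun ℂ (Fin 1))]
    simp [Matrix.trace, LinearMap.toMatrix_eq_toMatrix']
  let f : G →* ℂ := (LinearMap.det : Module.End ℂ (Fin 1 → ℂ) →* ℂ).comp ρ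
  have hf : ∀ g, f g = ρ.character g := fun g => hdet (ρ g)
  refine isCyclic_of_injective_ringHom (R := ℂ)
    (QuotientGroup.lift _ f fun g hg => MonoidHom.mem_ker.mpr ((hf g).trans (hg.trans h))) ?_
  refine (injective_iff_map_eq_one _).mpr fun q hq => ?_
  obtain ⟨g, rfl⟩ := QuotientGroup.mk_surjective q
  exact (QuotientGroup.eq_one_iff g).mpr (((hf g).symm.trans hq).trans h.symm)

end Irr

/-! ### Codegrees of groups of maximal class -/

section MaximalClass

theorem one_mem_cod (G : Type*) [Group G] [Finite G] : 1 ∈ cod G := by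
  let ρ : Representation ℂ G (Fin 1 → ℂ) := Representation.trivial ℂ G _
  have hρ : ρ.IsIrreducible := by
    have : IsSimpleModule ℂ (Fin 1 → ℂ) := isSimpleModule_iff_finrank_eq_one.mpr (by simp)
    exact (Representation.isIrreducible_iff_forall_submodule ρ).mpr
      ⟨inferInstance, fun U _ => eq_bot_or_eq_top U⟩
  refine ⟨⟨_, 1, ρ, hρ, rfl⟩, ?_⟩
  have hker : charKer (⟨_, 1, ρ, hρ, rfl⟩ : Irr G) = ⊤ := eq_top_iff.mpr fun g _ => rfl
  simp [codegree, hker, Representation.char_one]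

variable {p : ℕ}

theorem cod_of_card_eq_prime_sq_of_not_isCyclic (hp : p.Prime) {G : Type*} [Group G] [Finite G]
    (h : Nat.card G = p ^ 2) (hG : ¬ IsCyclic G) (hcomm : ∀ a b : G, a * b = b * a) :
    cod G = {x : ℂ | ∃ i ≤ 1, x = (p : ℂ) ^ i} := by
  have hcod : ∀ χ : Irr G, codegree χ = (charKer χ).index := fun χ => by
    rw [codegree, Irr.apply_one_eq_one_of_comm χ hcomm, div_one]
  have hindex : ∀ χ : Irr G, ∃ i ≤ 1, (charKer χ).index = p ^ i := by
    intro χ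
    obtain ⟨i, hi, hi'⟩ := (Nat.dvd_prime_pow hp).mp (h ▸ (charKer χ).index_dvd_card)
    refine ⟨i, ?_, hi'⟩
    by_contra hi1
    obtain rfl : i = 2 := by omega
    have hker : charKer χ = ⊥ := by
      have := (charKer χ).card_mul_index
      rw [hi', h] at this
      exact Subgroup.card_eq_one.mp (Nat.eq_of_mul_eq_mul_right (pow_pos hp.pos 2)
        (this.trans (one_mul _).symm))
    have := isCyclic_quotient_charKer (Irr.apply_one_eq_one_of_comm χ hcomm)
    refine hG (isCyclic_of_injective (QuotientGroup.mk' (charKer χ)) ?_)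
    rw [← MonoidHom.ker_eq_bot_iff, QuotientGroup.ker_mk', hker]
  ext x
  constructor
  · rintro ⟨χ, rfl⟩
    obtain ⟨i, hi, hi'⟩ := hindex χ
    exact ⟨i, hi, by simp [hcod, hi']⟩
  · rintro ⟨i, hi, rfl⟩
    interval_cases i
    · simpa using one_mem_cod G
    · have : Nontrivial G :=
        Finite.one_lt_card_iff_nontrivial.mp (h ▸ Nat.one_lt_pow two_ne_zero hp.one_lt)
      obtain ⟨z, hz⟩ := exists_ne (1 : G)
      obtain ⟨χ, hχ⟩ := exists_irr_notMem_charKer hz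
      obtain ⟨i, hi, hi'⟩ := hindex χ
      refine ⟨χ, ?_⟩
      interval_cases i
      · rw [pow_zero, Subgroup.index_eq_one] at hi'
        exact absurd (hi' ▸ Subgroup.mem_top z) hχ
      · simp [hcod, hi']

/-- If a group of maximal class has a faithful irreducible character of degree `p`, then all its
irreducible characters have degree at most `p`. -/
theorem Irr.apply_one_le_of_charKer_eq_bot (hp : p.Prime) {G : Type*} [Group G] [Finite G]
    (hG : IsPGroup p G) (hZ : Nat.card (Subgroup.center G) = p)
    (hnt : Nontrivial (G ⧸ Subgroup.center G)) {χ : Irr G} (hχ : charKer χ = ⊥)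
    (hχp : χ.1 1 = p) (ψ : Irr G) {d : ℕ} (hψ : ψ.1 1 = d) : d ≤ p := by
  have := Fact.mk hp
  obtain ⟨a, ha, ha'⟩ := hG.exists_notMem_center_forall_commutator_mem_center
  obtain ⟨ψ, e, σ, hσ, rfl⟩ := ψ
  obtain ⟨χ, c, ρ, hρ, rfl⟩ := χ
  replace hψ : finrank ℂ (Fin e → ℂ) = d := by
    exact_mod_cast (Representation.char_one σ).symm.trans hψ
  replace hχp : finrank ℂ (Fin c → ℂ) = p := by
    exact_mod_cast (Representation.char_one ρ).symm.trans hχp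
  rw [← hψ]
  refine Representation.finrank_le_of_injective_of_finrank_eq_card_center hp hZ ha ha' hρ ?_ hχp hσ
  refine (injective_iff_map_eq_one ρ).mpr fun g hg => ?_
  have : g ∈ charKer (⟨_, c, ρ, hρ, rfl⟩ : Irr G) := (rep_eq_one_iff ρ g).mp hg
  rwa [hχ] at this

/-- The codegrees of a noncyclic `p`-group of maximal class with character degrees in
`{1, p, p ^ 2}`, according to whether the degree `p ^ 2` occurs. -/
theorem cod_of_nilpotencyClass_eq (hp : p.Prime) {n : ℕ} (hn : 2 ≤ n) :
    ∀ (G : Type*) [Group G] [Finite G], Nat.card G = p ^ n → Group.nilpotencyClass G = n - 1 →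
      Group.IsNilpotent G → ¬ IsCyclic G → cd G ⊆ {1, (p : ℂ), (p : ℂ) ^ 2} →
      (cd G ⊆ {1, (p : ℂ)} → cod G = {x : ℂ | ∃ i ≤ n - 1, x = (p : ℂ) ^ i}) ∧
      (¬ cd G ⊆ {1, (p : ℂ)} → cod G = {x : ℂ | ∃ i ≤ n - 2, x = (p : ℂ) ^ i}) := by
  have hpF := Fact.mk hp
  have hp0 : (p : ℂ) ≠ 0 := Nat.cast_ne_zero.mpr hp.ne_zero
  induction n, hn using Nat.le_induction with
  | base =>
    intro G _ _ hcard hclass hnil hcyc _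
    have hcomm := isMulCommutative_iff.mp (IsPGroup.isMulCommutative_of_card_eq_prime_sq hcard)
    refine ⟨fun _ => cod_of_card_eq_prime_sq_of_not_isCyclic hp hcard hcyc hcomm, fun h => ?_⟩
    refine absurd ?_ h
    rintro _ ⟨χ, rfl⟩
    exact Or.inl (Irr.apply_one_eq_one_of_comm χ hcomm)
  | succ n hn ih =>
    intro G _ _ hcard hclass hnil hcyc hcd
    obtain ⟨hZ, hq⟩ := card_center_of_nilpotencyClass_eq hp (by omega) hcard hclass
    have hclassq : Group.nilpotencyClass (G ⧸ Subgroup.center G) = n - 1 := by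
      rw [Group.nilpotencyClass_quotient_center, hclass]; rfl
    have hncomm : ¬ IsMulCommutative G := fun h => by
      have := Group.IsNilpotent.nilpotencyClass_le_one_iff.mpr h
      omega
    have hcycq : ¬ IsCyclic (G ⧸ Subgroup.center G) := fun h => by
      have := nilpotencyClass_le_one_of_isCyclic_quotient_center (G := G)
      omega
    have hntq : Nontrivial (G ⧸ Subgroup.center G) := by
      by_contra h
      rw [not_nontrivial_iff_subsingleton] at h
      exact hcycq inferInstance
    have hsub := cd_quotient_subset (Subgroup.center G)
    have IH := ih (G ⧸ Subgroup.center G) hq hclassq inferInstance hcycq (hsub.trans hcd)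
    have hpG : IsPGroup p G := IsPGroup.of_card hcard
    -- The centre has prime order, so a kernel not containing it meets it trivially.
    have hfaithful : ∀ χ : Irr G, ¬ Subgroup.center G ≤ charKer χ → charKer χ = ⊥ := by
      intro χ hχ
      by_contra hne
      refine hpG.inf_center_ne_bot hne (Subgroup.card_eq_one.mp ?_)
      have hdvd := Subgroup.card_dvd_of_le (inf_le_right : charKer χ ⊓ Subgroup.center G ≤ _)
      rw [hZ] at hdvd
      refine ((Nat.dvd_prime hp).mp hdvd).resolve_right fun h => hχ ?_
      exact inf_eq_right.mp (Subgroup.eq_of_le_of_card_ge inf_le_right (hZ.trans h.symm).le)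
    have hlin : ∀ χ : Irr G, ¬ Subgroup.center G ≤ charKer χ → χ.1 1 ≠ 1 := by
      intro χ hχ h1
      have := isCyclic_quotient_charKer h1
      refine hncomm (MonoidHom.isMulCommutative_of_isCyclic_of_ker_le_center
        (QuotientGroup.mk' (charKer χ)) ?_)
      rw [QuotientGroup.ker_mk', hfaithful χ hχ]
      exact bot_le
    obtain ⟨χ₀, hχ₀⟩ : ∃ χ : Irr G, ¬ Subgroup.center G ≤ charKer χ := by
      have : Nontrivial G := (QuotientGroup.mk'_surjective (Subgroup.center G)).nontrivial
      have := hpG.center_nontrivial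
      obtain ⟨⟨z, hz⟩, hz1⟩ := exists_ne (1 : Subgroup.center G)
      obtain ⟨χ, hχ⟩ := exists_irr_notMem_charKer (z := z) fun h => hz1 (Subtype.ext h)
      exact ⟨χ, fun h => hχ (h hz)⟩
    have hdeg : ∀ e ≤ n + 1, (∀ χ : Irr G, ¬ Subgroup.center G ≤ charKer χ → χ.1 1 = (p : ℂ) ^ e) →
        cod G = cod (G ⧸ Subgroup.center G) ∪ {(p : ℂ) ^ (n + 1 - e)} := by
      intro e he hχe
      have hcodχ : ∀ χ : Irr G, ¬ Subgroup.center G ≤ charKer χ →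
          codegree χ = (p : ℂ) ^ (n + 1 - e) := by
        intro χ hχ
        rw [codegree_of_charKer_eq_bot (hfaithful χ hχ), hχe χ hχ, hcard, Nat.cast_pow,
          pow_sub₀ _ hp0 he, div_eq_mul_inv]
      rw [cod_eq_cod_quotient_union (Subgroup.center G)]
      congr 1
      ext x
      constructor
      · rintro ⟨χ, hχ, rfl⟩
        exact hcodχ χ hχ
      · rintro rfl
        exact ⟨χ₀, hχ₀, hcodχ χ₀ hχ₀⟩
    have hunion : ∀ m k : ℕ, m ≤ k → k ≤ m + 1 →
        {x : ℂ | ∃ i ≤ m, x = (p : ℂ) ^ i} ∪ {(p : ℂ) ^ k} = {x : ℂ | ∃ i ≤ k, x = (p : ℂ) ^ i} := by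
      intro m k hmk hkm
      ext x
      constructor
      · rintro (⟨i, hi, rfl⟩ | rfl)
        · exact ⟨i, hi.trans hmk, rfl⟩
        · exact ⟨k, le_rfl, rfl⟩
      · rintro ⟨i, hi, rfl⟩
        rcases hi.eq_or_lt with rfl | hi
        · exact Or.inr rfl
        · exact Or.inl ⟨i, by omega, rfl⟩
    refine ⟨fun hcdp => ?_, fun hcdp => ?_⟩
    · rw [hdeg 1 (by omega) fun χ hχ => by
        rw [pow_one]; exact (hcdp ⟨χ, rfl⟩).resolve_left (hlin χ hχ), IH.1 (hsub.trans hcdp)]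
      exact hunion (n - 1) n (by omega) (by omega)
    · have hsq : ∀ χ : Irr G, ¬ Subgroup.center G ≤ charKer χ → χ.1 1 = (p : ℂ) ^ 2 := by
        intro χ hχ
        refine ((hcd ⟨χ, rfl⟩).resolve_left (hlin χ hχ)).resolve_left fun hχp => hcdp ?_
        rintro _ ⟨ψ, rfl⟩
        rcases hcd ⟨ψ, rfl⟩ with h | h | h
        · exact Or.inl h
        · exact Or.inr h
        · have := Irr.apply_one_le_of_charKer_eq_bot hp hpG hZ hntq (hfaithful χ hχ) hχp ψ
            (d := p ^ 2) (by rw [Nat.cast_pow]; exact h)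
          nlinarith [hp.two_le]
      rw [hdeg 2 (by omega) hsq]
      -- The new codegree is `p ^ (n - 1)`. It is already present if the quotient lost the degree `p
      -- ^ 2`, and otherwise extends the exponents by one.
      by_cases hq' : cd (G ⧸ Subgroup.center G) ⊆ {1, (p : ℂ)}
      · rw [IH.1 hq']
        exact hunion (n - 1) (n - 1) le_rfl (by omega)
      · rw [IH.2 hq']
        exact hunion (n - 2) (n - 1) (by omega) (by omega)

end MaximalClass

theorem mainTheorem5 (p : ℕ) (hp : p.Prime) (n : ℕ) (G : Type*) [Group G] [Finite G]
    (hcard : Nat.card G = p ^ n) (hmax : IsMaximalClass p G)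
    (hcd : cd G = {1, (p : ℂ), (p : ℂ) ^ 2}) :
    cod G = {x : ℂ | ∃ i : ℕ, i + 2 ≤ n ∧ x = (p : ℂ) ^ i} := by
  obtain ⟨m, hm, hm', hnil, hclass⟩ := hmax
  obtain rfl : m = n := Nat.pow_right_injective hp.two_le (hm'.symm.trans hcard)
  have hp1 : (p : ℂ) ≠ 1 := by exact_mod_cast hp.ne_one
  -- The cyclic group of order `p ^ 2` meets the definition of maximal class; the degree `p`
  -- excludes it.
  have hcyc : ¬ IsCyclic G := by
    intro h
    obtain ⟨χ, hχ⟩ : (p : ℂ) ∈ cd G := by rw [hcd]; simp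
    refine hp1 (hχ.symm.trans (Irr.apply_one_eq_one_of_comm χ fun a b => ?_))
    exact (IsCyclic.commGroup (α := G)).mul_comm a b
  have hsq : ¬ cd G ⊆ {1, (p : ℂ)} := by
    intro h
    rcases h (hcd ▸ by simp : (p : ℂ) ^ 2 ∈ cd G) with h | h
    · have h' : p ^ 2 = 1 := by exact_mod_cast h
      nlinarith [hp.two_le]
    · have h' : p ^ 2 = p := by exact_mod_cast (Set.mem_singleton_iff.mp h)
      nlinarith [hp.two_le]
  rw [(cod_of_nilpotencyClass_eq hp hm G hcard hclass hnil hcyc hcd.le).2 hsq]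
  ext x
  exact exists_congr fun i => and_congr_left' (by omega)
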